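/- Let $n\ge 0$ be an integer and let $B$ be an analytic function on the open upper half-plane $\mathbb{C}_+$ with values in the complex $n\times n$ matrices, which is contractive: $\|B(w)\|\le 1$ for all $w\in\mathbb{C}_+$, in the Euclidean operator norm. Let $\alpha$ be a unitary $n\times n$ matrix such that $I-B(w)\alpha^*$ is invertible for every $w\in\mathbb{C}_+$. Let $\gamma(w)=\frac{w-i}{w+i}$ be the Cayley transform, let $b$ be the function on the unit disk $\mathbb{D}$ with $B=b\circ\gamma$, and put $h_\alpha(\zeta)=(I-b(\zeta)\alpha^*)^{-1}(I+b(\zeta)\alpha^*)$. The Clark measure $\mu^{b\alpha^*}$ on the unit circle $\mathbb{T}$ is the countably additive Borel measure with positive semidefinite matrix values for which $$\operatorname{Re} h_\alpha(\zeta)=\tfrac12\bigl(h_\alpha(\zeta)+h_\alpha(\zeta)^*\bigr)=\int_{\mathbb{T}}\frac{1-|\zeta|^2}{|\lambda-\zeta|^2}\,\mu^{b\alpha^*}(d\lambda)\qquad(\zeta\in\mathbb{D}),$$ and the Clark measure $\mu^{B\alpha^*}$ on $\mathbb{R}$ is $$\mu^{B\alpha^*}(\Omega)=\int_\Omega\frac{1}{\pi(1+t^2)}\,(\mu^{b\alpha^*}\circ\gamma)(dt)\qquad(\Omega\subseteq\mathbb{R}\text{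 Borel}),$$ where $(\mu^{b\alpha^*}\circ\gamma)(\Omega)=\mu^{b\alpha^*}(\gamma(\Omega))$. Then the Clark measure $\mu^{B\alpha^*}$ exists and is unique, and for every $s\in\mathbb{R}$ the limit below exists and $$\mu^{B\alpha^*}(\{s\})=\frac{2i}{\pi(1+s^2)^2}\,\lim_{w\downarrow s}(s-w)\,(I-B(w)\alpha^*)^{-1},$$ where $w\downarrow s$ means that $w\in\mathbb{C}_+$ tends to $s$ non-tangentially, that is, within each region $\{|\operatorname{Re}w-s|\le\kappa\operatorname{Im}w\}$ with $\kappa>0$. -/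

import Mathlib

open scoped Matrix Matrix.Norms.L2Operator Topology ComplexOrder

namespace MatrixClark

/-- The open upper half-plane. -/
def upperHalf : Set ℂ := {w : ℂ | 0 < w.im}

/-- The unit circle, with its Borel structure as a subspace of the plane. -/
abbrev UnitCircle : Type := Metric.sphere (0 : ℂ) 1

/-- The class of contractive analytic matrix functions on an open set `X` of the plane.
The norm on matrices is the operator norm on Euclidean space. -/
structure IsContractiveAnalytic {n : ℕ} (X : Set ℂ) (B : ℂ → Matrix (Fin n) (Fin n) ℂ) :
    Prop where
  analytic : DifferentiableOn ℂ B X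
  contractive : ∀ w ∈ X, ‖B w‖ ≤ 1

/-- The Cayley transform of the upper half-plane onto the unit disk. -/
noncomputable def cayley (w : ℂ) : ℂ := (w - Complex.I) / (w + Complex.I)

/-- The inverse of the Cayley transform. -/
noncomputable def cayleyInv (z : ℂ) : ℂ := Complex.I * (1 + z) / (1 - z)

/-- The function `(I - C)⁻¹ (I + C)`; here `C` is the function `z ↦ b(z) α*`. -/
noncomputable def herglotz {n : ℕ} (C : ℂ → Matrix (Fin n) (Fin n) ℂ) (z : ℂ) :
    Matrix (Fin n) (Fin n) ℂ :=
  (1 - C z)⁻¹ * (1 + C z)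

/-- `ν` is the Clark measure on the circle of the contractive function `C` on the disk: a
countably additive set function whose values are positive semidefinite matrices, and whose Poisson
integral is the real part of the function `(I - C)⁻¹ (I + C)`. -/
structure IsDiskClarkMeasure {n : ℕ} (C : ℂ → Matrix (Fin n) (Fin n) ℂ)
    (ν : MeasureTheory.VectorMeasure UnitCircle (Matrix (Fin n) (Fin n) ℂ)) : Prop where
  posSemidef : ∀ E : Set UnitCircle, MeasurableSet E → (ν E).PosSemidef
  poisson : ∀ z : ℂ, ‖z‖ < 1 →
    (2⁻¹ : ℂ) • (herglotz C z + (herglotz C z)ᴴ) =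
      ∫ᵛ l : UnitCircle, ((1 - ‖z‖ ^ 2) / ‖(l : ℂ) - z‖ ^ 2 : ℝ) ∂•ν

/-- The set function `Ω ↦ ν (γ(Ω))` on the line, where `γ` is the Cayley transform; the point `1`
of the circle, which is not in the image of the line, is removed first. -/
noncomputable def cayleyPullback {n : ℕ}
    (ν : MeasureTheory.VectorMeasure UnitCircle (Matrix (Fin n) (Fin n) ℂ)) :
    MeasureTheory.VectorMeasure ℝ (Matrix (Fin n) (Fin n) ℂ) :=
  (ν.restrict {l : UnitCircle | (l : ℂ) ≠ 1}).map (fun l : UnitCircle => (cayleyInv (l : ℂ)).re)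

theorem measurable_cayleyInv_re :
    Measurable (fun l : UnitCircle => (cayleyInv (l : ℂ)).re) := by
  unfold cayleyInv
  fun_prop

theorem cayley_mem_iff (l : UnitCircle) (t : ℝ) :
    (l : ℂ) = cayley t ↔ (l : ℂ) ≠ 1 ∧ (cayleyInv (l : ℂ)).re = t := by
  have hl : Complex.normSq (l : ℂ) = 1 := by
    have h := l.2
    rw [mem_sphere_zero_iff_norm] at h
    rw [Complex.normSq_eq_norm_sq, h, one_pow]
  have ht : (t : ℂ) + Complex.I ≠ 0 := by
    intro h
    have := congrArg Complex.im h
    simp at this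
  have hI := Complex.I_sq
  unfold cayley cayleyInv
  constructor
  · intro h
    have h1 : (l : ℂ) ≠ 1 := by
      rw [h]
      intro h2
      rw [div_eq_one_iff_eq ht] at h2
      have := congrArg Complex.im h2
      norm_num at this
    refine ⟨h1, ?_⟩
    have h2 : (1 : ℂ) - l ≠ 0 := sub_ne_zero.mpr (Ne.symm h1)
    have h3 : Complex.I * (1 + (l : ℂ)) / (1 - l) = t := by
      rw [div_eq_iff h2]
      rw [eq_div_iff ht] at h
      linear_combination h
    rw [h3, Complex.ofReal_re]
  · rintro ⟨h1, h2⟩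
    have h3 : (1 : ℂ) - l ≠ 0 := sub_ne_zero.mpr (Ne.symm h1)
    have him : (Complex.I * (1 + (l : ℂ)) / (1 - l)).im = 0 := by
      rw [Complex.div_im]
      rw [Complex.normSq_apply] at hl
      have : Complex.normSq (1 - (l : ℂ)) ≠ 0 := by simpa using h3
      field_simp
      simp
      linear_combination -hl
    have h4 : Complex.I * (1 + (l : ℂ)) / (1 - l) = t := by
      apply Complex.ext
      · simpa using h2
      · simpa using him
    rw [eq_div_iff ht]
    rw [div_eq_iff h3] at h4
    linear_combination h4

theorem cayleyPullback_apply {n : ℕ}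
    (ν : MeasureTheory.VectorMeasure UnitCircle (Matrix (Fin n) (Fin n) ℂ))
    {Ω : Set ℝ} (hΩ : MeasurableSet Ω) :
    cayleyPullback ν Ω = ν {l : UnitCircle | ∃ t ∈ Ω, (l : ℂ) = cayley t} := by
  have h1 : MeasurableSet {l : UnitCircle | (l : ℂ) ≠ 1} :=
    (measurableSet_eq_fun measurable_subtype_coe measurable_const).compl
  rw [cayleyPullback, MeasureTheory.VectorMeasure.map_apply _ measurable_cayleyInv_re hΩ,
    MeasureTheory.VectorMeasure.restrict_apply _ h1 (measurable_cayleyInv_re hΩ)]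
  congr 1
  ext l
  simp only [Set.mem_inter_iff, Set.mem_preimage, Set.mem_ofPred_eq, cayley_mem_iff]
  constructor
  · rintro ⟨h2, h3⟩
    exact ⟨_, h2, h3, rfl⟩
  · rintro ⟨t, ht, h3, rfl⟩
    exact ⟨ht, h3⟩

/-- `μ` is the Clark measure on the line of `B α*`: with `b` the function on the disk such that
`B = b ∘ γ`, and `ν` the Clark measure of `b α*` on the circle, it is given by
`μ(Ω) = ∫_Ω 1 / (π (1 + t²)) (ν ∘ γ)(dt)`. -/
def IsClarkMeasure {n : ℕ} (B : ℂ → Matrix (Fin n) (Fin n) ℂ) (α : Matrix (Fin n) (Fin n) ℂ)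
    (μ : MeasureTheory.VectorMeasure ℝ (Matrix (Fin n) (Fin n) ℂ)) : Prop :=
  ∃ ν : MeasureTheory.VectorMeasure UnitCircle (Matrix (Fin n) (Fin n) ℂ),
    IsDiskClarkMeasure (fun z => B (cayleyInv z) * αᴴ) ν ∧
    μ = (cayleyPullback ν).withDensity (fun t : ℝ => 1 / (Real.pi * (1 + t ^ 2)))
      (ContinuousLinearMap.lsmul ℝ ℝ)

/-- The function `f` on the upper half-plane has the non-tangential limit `L` at the point `s` of
the line. -/
def NontangentialTendsto {n : ℕ} (f : ℂ → Matrix (Fin n) (Fin n) ℂ) (s : ℝ)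
    (L : Matrix (Fin n) (Fin n) ℂ) : Prop :=
  ∀ κ : ℝ, 0 < κ →
    Filter.Tendsto f (𝓝[{w : ℂ | 0 < w.im ∧ |w.re - s| ≤ κ * w.im}] (s : ℂ)) (𝓝 L)

end MatrixClark

/-! Write `C` for `b α*` and `H = (1 - C)⁻¹(1 + C)`. Since `α` is unitary, `C` is contractive, so
`Re H ≥ 0`: every scalar function `v* H v` has nonnegative real part on the disk. The scalar
Herglotz theorem (`exists_measure_poisson`) gives each of them a finite measure on the circle, and
polarization assembles these into one matrix measure (`exists_vectorMeasure_poisson`). Uniqueness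
holds because a Poisson integral determines all moments of a measure; it passes to signed measures
by Jordan decomposition and to matrix measures by linear functionals
(`vectorMeasure_ext_of_poisson`).

For the point masses, a scalar `f` with `Re f` the Poisson integral of `m` equals `∫ (l + z)/(l - z)
dm` plus a constant. After multiplication by `s - w` and `z = γ(w)`, the kernel is bounded in each
non-tangential region and tends to `-i(1 + s²)` at `l = γ(s)` and to `0` elsewhere, so dominated
convergence isolates the mass at `γ(s)` (`tendsto_mul_integral_herglotz_kernel`). Polarization gives
the matrix limit, and `(1 - C)⁻¹ = (H + 1)/2` turns it into the formula. -/

namespace MatrixClark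

open MeasureTheory

/-! ### Vector measures: finite variation and linear images -/

section VectorMeasure

variable {X F G : Type*} [MeasurableSpace X] [NormedAddCommGroup F] [NormedSpace ℝ F]
  [NormedAddCommGroup G] [NormedSpace ℝ G]

/-- The image of a vector measure under a continuous linear map of the values. -/
noncomputable def mapCLM (ν : VectorMeasure X F) (ℓ : F →L[ℝ] G) : VectorMeasure X G :=
  ν.mapRange ℓ.toLinearMap.toAddMonoidHom ℓ.continuous

@[simp]
theorem mapCLM_apply (ν : VectorMeasure X F) (ℓ : F →L[ℝ] G) (E : Set X) :
    mapCLM ν ℓ E = ℓ (ν E) := rfl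

theorem isFiniteMeasure_variation_signedMeasure (s : SignedMeasure X) :
    IsFiniteMeasure s.variation := by
  rw [← SignedMeasure.totalVariation_eq_variation, SignedMeasure.totalVariation]
  infer_instance

/-- In a basis, the variation is dominated by a weighted sum of the variations of the coordinates,
which are signed measures and hence of finite variation. This makes continuous functions on the
circle integrable against any matrix measure. -/
theorem isFiniteMeasure_variation [FiniteDimensional ℝ F] (ν : VectorMeasure X F) :
    IsFiniteMeasure ν.variation := by
  let b := Module.finBasis ℝ F
  let m : Measure X :=
    ∑ k, ‖b k‖₊ • (mapCLM ν (b.coord k).toContinuousLinearMap).variation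
  have hm : IsFiniteMeasure m := by
    have (k : _) := isFiniteMeasure_variation_signedMeasure
      (mapCLM ν (b.coord k).toContinuousLinearMap)
    infer_instance
  refine isFiniteMeasure_of_le m (VectorMeasure.variation_le_of_forall_enorm_le fun E _ ↦ ?_)
  calc ‖ν E‖ₑ = ‖∑ k, b.repr (ν E) k • b k‖ₑ := by rw [b.sum_repr]
    _ ≤ ∑ k, ‖b.repr (ν E) k • b k‖ₑ := enorm_sum_le _ _
    _ ≤ ∑ k, ‖b k‖₊ * (mapCLM ν (b.coord k).toContinuousLinearMap).variation E := by
      gcongr with k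
      rw [enorm_smul, mul_comm, enorm_eq_nnnorm (b k)]
      gcongr
      exact VectorMeasure.enorm_measure_le_variation
        (μ := mapCLM ν (b.coord k).toContinuousLinearMap) (E := E)
    _ = m E := by
      simp [m, Measure.finsetSum_apply]

theorem variation_mapCLM_le (ν : VectorMeasure X F) (ℓ : F →L[ℝ] G) :
    (mapCLM ν ℓ).variation ≤ (‖ℓ‖₊ : ENNReal) • ν.variation := by
  refine VectorMeasure.variation_le_of_forall_enorm_le fun E _ ↦ ?_
  rw [mapCLM_apply]
  refine (ℓ.le_opENorm _).trans ?_
  rw [Measure.smul_apply, smul_eq_mul, enorm_eq_nnnorm ℓ]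
  gcongr
  exact VectorMeasure.enorm_measure_le_variation (μ := ν) (E := E)

theorem transpose_lsmul_apply (ν : VectorMeasure X F) (E : Set X) :
    ν.transpose (ContinuousLinearMap.lsmul ℝ ℝ) E =
      (ContinuousLinearMap.lsmul ℝ ℝ).flip (ν E) := rfl

theorem clm_integral_smul [CompleteSpace F] [CompleteSpace G] (ν : VectorMeasure X F)
    (ℓ : F →L[ℝ] G) {f : X → ℝ} (hf : ν.Integrable f) :
    ℓ (∫ᵛ x, f x ∂•ν) = ∫ᵛ x, f x ∂•(mapCLM ν ℓ) := by
  have hT := VectorMeasure.integral_eq_setToFun (μ := mapCLM ν ℓ) (f := f)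
    (B := ContinuousLinearMap.lsmul ℝ ℝ)
  have hD : DominatedFinMeasAdditive ν.variation
      ((mapCLM ν ℓ).transpose (ContinuousLinearMap.lsmul ℝ ℝ))
      ‖ℓ‖ := by
    refine ⟨fun s t hs ht _ _ h ↦ VectorMeasure.of_union h hs ht, fun s hs hsf ↦ ?_⟩
    rw [transpose_lsmul_apply]
    refine ContinuousLinearMap.opNorm_le_bound _ (by positivity) fun c ↦ ?_
    rw [ContinuousLinearMap.flip_apply, ContinuousLinearMap.lsmul_apply, mapCLM_apply, norm_smul,
      mul_comm]
    gcongr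
    refine (ℓ.le_opNorm _).trans ?_
    gcongr
    exact VectorMeasure.norm_measure_le_variation hsf.ne
  -- The two integrals are built on different variation measures. The bound of one by a multiple of
  -- the other moves both to `ν.variation`, where induction on integrable functions applies.
  rw [hT, ← setToFun_congr_measure_of_integrable (‖ℓ‖₊ : ENNReal) (by simp)
    (variation_mapCLM_le ν ℓ) hD _ f hf]
  refine Integrable.induction (μ := ν.variation)
    (fun f ↦ ℓ (∫ᵛ x, f x ∂•ν) = setToFun ν.variation _ hD f) ?_ ?_ ?_ ?_ hf
  · intro c s hs hsf
    rw [VectorMeasure.integral_eq_setToFun, setToFun_indicator_const _ hs hsf.ne,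
      setToFun_indicator_const _ hs hsf.ne]
    rw [transpose_lsmul_apply, transpose_lsmul_apply]
    simp
  · intro f g _ hf hg h1 h2
    rw [setToFun_add hD hf hg, ← h1, ← h2, ← map_add]
    congr 1
    exact VectorMeasure.integral_add hf hg
  · exact isClosed_eq (ℓ.continuous.comp (VectorMeasure.continuous_integral))
      (continuous_setToFun hD)
  · intro f g hfg hf h
    rw [← setToFun_congr_ae hD hfg, ← h, VectorMeasure.integral_congr_ae hfg]

theorem integral_smul_toSignedMeasure {m : Measure X} [IsFiniteMeasure m] (f : X → ℝ) :
    ∫ᵛ x, f x ∂•m.toSignedMeasure = ∫ x, f x ∂m := by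
  rw [← VectorMeasure.integral_toSignedMeasure]
  congr 1
  ext
  simp

end VectorMeasure

/-! ### The Poisson kernel and uniqueness of the representing measure -/

theorem norm_unitCircle (l : UnitCircle) : ‖(l : ℂ)‖ = 1 := mem_sphere_zero_iff_norm.mp l.2

theorem unitCircle_sub_ne_zero (l : UnitCircle) {z : ℂ} (hz : ‖z‖ < 1) : (l : ℂ) - z ≠ 0 := by
  intro h
  rw [← sub_eq_zero.mp h, norm_unitCircle] at hz
  exact lt_irrefl _ hz

theorem poissonKernel_unitCircle (z : ℂ) (l : UnitCircle) :
    poissonKernel 0 z l = (1 - ‖z‖ ^ 2) / ‖(l : ℂ) - z‖ ^ 2 := by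
  simp [poissonKernel_def]

theorem re_herglotz_kernel (z : ℂ) (l : UnitCircle) :
    (((l : ℂ) + z) / (l - z)).re = poissonKernel 0 z l := by
  rw [poissonKernel_eq_re_herglotzRieszKernel]
  simp [herglotzRieszKernel_def]

theorem continuous_poissonKernel {z : ℂ} (hz : ‖z‖ < 1) :
    Continuous fun l : UnitCircle ↦ poissonKernel 0 z l := by
  simp only [poissonKernel_unitCircle]
  refine Continuous.div (by fun_prop) (by fun_prop) fun l ↦ ?_
  have := unitCircle_sub_ne_zero l hz
  positivity

/-- For `ω` and `l` on the circle, `|l - rω| = |ω - rl|`. This lets the integration variable and the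
pole trade places after Fubini. -/
theorem poissonKernel_symm {ω l : ℂ} (hω : ‖ω‖ = 1) (hl : ‖l‖ = 1) (r : ℝ) :
    poissonKernel 0 (r * ω) l = poissonKernel 0 (r * l) ω := by
  have h : ‖l - r * ω‖ ^ 2 = ‖ω - r * l‖ ^ 2 := by
    have h1 : ‖ω‖ ^ 2 = ‖l‖ ^ 2 := by rw [hω, hl]
    rw [Complex.sq_norm, Complex.sq_norm, Complex.normSq_apply, Complex.normSq_apply] at h1 ⊢
    simp
    linear_combination (r ^ 2 - 1) * h1
  simp [poissonKernel_def, hω, hl, h]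

theorem integrable_of_continuous {m : Measure UnitCircle} [IsFiniteMeasure m] {E : Type*}
    [NormedAddCommGroup E] {f : UnitCircle → E} (hf : Continuous f) : Integrable f m :=
  hf.integrable_of_hasCompactSupport (HasCompactSupport.of_compactSpace f)

/-- After Fubini and the symmetry of the kernel, the inner integral is the Poisson integral of the
analytic function `z ↦ z ^ k` at `r l`, that is, `(r l) ^ k`. Thus the Poisson integral on one
circle of radius `r > 0` already determines the moments. -/
theorem circleAverage_pow_mul_poisson (m : Measure UnitCircle) [IsFiniteMeasure m] (k : ℕ)
    {r : ℝ} (hr0 : 0 ≤ r) (hr : r < 1) :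
    Real.circleAverage
      (fun ω ↦ ω ^ k * ((∫ l : UnitCircle, poissonKernel 0 (r * ω) l ∂m : ℝ) : ℂ)) 0 1 =
    (r : ℂ) ^ k * ∫ l : UnitCircle, (l : ℂ) ^ k ∂m := by
  have hn (θ : ℝ) : ‖(r : ℂ) * circleMap 0 1 θ‖ < 1 := by
    simpa [abs_of_nonneg hr0] using hr
  have hmul (l : UnitCircle) : ‖(r : ℂ) * l‖ < 1 := by
    simpa [norm_unitCircle, abs_of_nonneg hr0] using hr
  have hc : Continuous fun p : ℝ × UnitCircle ↦
      circleMap 0 1 p.1 ^ k * (poissonKernel 0 (r * circleMap 0 1 p.1) p.2 : ℂ) := by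
    have h1 : Continuous fun p : ℝ × UnitCircle ↦
        poissonKernel 0 (r * circleMap 0 1 p.1) p.2 := by
      simp only [poissonKernel_unitCircle]
      refine Continuous.div (by fun_prop) (by fun_prop) fun p ↦ ?_
      have := unitCircle_sub_ne_zero p.2 (hn p.1)
      positivity
    fun_prop
  have hint : Integrable (Function.uncurry fun (θ : ℝ) (l : UnitCircle) ↦
      circleMap 0 1 θ ^ k * (poissonKernel 0 (r * circleMap 0 1 θ) l : ℂ))
      ((volume.restrict (Set.Ioc 0 (2 * Real.pi))).prod m) := by
    have hK : IsCompact ((Set.Icc 0 (2 * Real.pi)) ×ˢ (Set.univ : Set UnitCircle)) :=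
      isCompact_Icc.prod isCompact_univ
    have h := hc.continuousOn.integrableOn_compact (μ := (volume : Measure ℝ).prod m) hK
    rw [IntegrableOn, ← Measure.prod_restrict, Measure.restrict_univ] at h
    refine h.mono_measure ?_
    exact Measure.prod_mono (Measure.restrict_mono Set.Ioc_subset_Icc_self le_rfl) le_rfl
  rw [Real.circleAverage_def, intervalIntegral.integral_of_le (by positivity)]
  simp_rw [← integral_complex_ofReal, ← integral_const_mul]
  rw [integral_integral_swap hint, ← integral_smul]
  refine integral_congr_ae (Filter.Eventually.of_forall fun l ↦ ?_)
  have h := DiffContOnCl.circleAverage_poissonKernel_smul (f := fun z : ℂ ↦ z ^ k) (c := 0)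
    (R := 1) (w := r * l) (Differentiable.diffContOnCl (by fun_prop)) (by simpa using hmul l)
  rw [Real.circleAverage_def, intervalIntegral.integral_of_le (by positivity)] at h
  simp only [mul_pow] at h
  beta_reduce
  rw [← h]
  congr 1
  refine integral_congr_ae (Filter.Eventually.of_forall fun θ ↦ ?_)
  simp only [Pi.smul_apply', Complex.real_smul]
  rw [poissonKernel_symm (by simp) (norm_unitCircle l), mul_comm]

theorem integral_pow_eq_of_poisson {m₁ m₂ : Measure UnitCircle} [IsFiniteMeasure m₁]
    [IsFiniteMeasure m₂] (h : ∀ z : ℂ, ‖z‖ < 1 →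
      ∫ l : UnitCircle, poissonKernel 0 z l ∂m₁ = ∫ l : UnitCircle, poissonKernel 0 z l ∂m₂)
    (k : ℕ) : ∫ l : UnitCircle, (l : ℂ) ^ k ∂m₁ = ∫ l : UnitCircle, (l : ℂ) ^ k ∂m₂ := by
  -- Any radius strictly between `0` and `1` would serve: it must be nonzero so that `r ^ k`
  -- cancels.
  have h1 := circleAverage_pow_mul_poisson m₁ k (r := 1 / 2) (by norm_num) (by norm_num)
  rw [Real.circleAverage_congr_sphere (f₂ := fun ω ↦ ω ^ k *
      ((∫ l : UnitCircle, poissonKernel 0 ((1 / 2 : ℝ) * ω) l ∂m₂ : ℝ) : ℂ)),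
    circleAverage_pow_mul_poisson m₂ k (by norm_num) (by norm_num)] at h1
  · exact (mul_left_cancel₀ (by norm_num) h1).symm
  · intro ω hω
    have hω : ‖ω‖ = 1 := by simpa using hω
    simp only
    rw [h _ (by rw [norm_mul, hω]; norm_num)]

/-- A finite measure on the circle is determined by its Poisson integral. -/
theorem measure_ext_of_poisson {m₁ m₂ : Measure UnitCircle} [IsFiniteMeasure m₁]
    [IsFiniteMeasure m₂] (h : ∀ z : ℂ, ‖z‖ < 1 →
      ∫ l : UnitCircle, poissonKernel 0 z l ∂m₁ = ∫ l : UnitCircle, poissonKernel 0 z l ∂m₂) :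
    m₁ = m₂ := by
  let c : BoundedContinuousFunction UnitCircle ℂ :=
    BoundedContinuousFunction.mkOfCompact ⟨fun l ↦ (l : ℂ), by fun_prop⟩
  have hc (l : UnitCircle) : c l = l := rfl
  have hinv (l : UnitCircle) : star (l : ℂ) * l = 1 := by
    have := Complex.conj_mul' (l : ℂ)
    rw [norm_unitCircle] at this
    simpa using this
  let A := StarAlgebra.adjoin ℂ ({c} : Set (BoundedContinuousFunction UnitCircle ℂ))
  refine ext_of_forall_mem_subalgebra_integral_eq_of_polish (𝕜 := ℂ) (A := A) ?_ ?_
  · intro x y hxy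
    refine ⟨fun l ↦ (l : ℂ), ⟨c.toContinuousMap, ⟨c, ?_, rfl⟩, rfl⟩, fun h ↦ hxy (Subtype.ext h)⟩
    exact StarAlgebra.self_mem_adjoin_singleton ℂ c
  · intro g hg
    have hg' : g ∈ Submodule.span ℂ
        ((Submonoid.closure ({c} ∪ star {c}) : Submonoid _) : Set _) := by
      rw [← StarAlgebra.adjoin_eq_span]
      exact hg
    have hpow (k : ℕ) := integral_pow_eq_of_poisson h k
    -- On the circle the conjugate of `l` is its inverse, so every monomial in `l` and its conjugate
    -- collapses to a pure power of one of them; its integral is a moment or the conjugate of a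
    -- moment.
    have hform : ∀ g ∈ Submonoid.closure ({c} ∪ star {c}),
        ∃ a b : ℕ, (a = 0 ∨ b = 0) ∧ ∀ l, g l = (l : ℂ) ^ a * star (l : ℂ) ^ b := by
      intro g hg
      induction hg using Submonoid.closure_induction_left with
      | one => exact ⟨0, 0, by simp, by simp⟩
      | mul_left x hx y hy ih =>
        obtain ⟨a, b, hab, hy⟩ := ih
        rcases hx with hx | hx
        · rw [Set.mem_singleton_iff] at hx
          subst hx
          rcases b with _ | b
          · exact ⟨a + 1, 0, by simp, fun l ↦ by
              rw [BoundedContinuousFunction.mul_apply, hc, hy, pow_succ]; ring⟩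
          · obtain rfl : a = 0 := by simpa using hab
            exact ⟨0, b, by simp, fun l ↦ by
              rw [BoundedContinuousFunction.mul_apply, hc, hy, pow_succ]
              linear_combination (star (l : ℂ)) ^ b * hinv l⟩
        · rw [Set.star_singleton, Set.mem_singleton_iff] at hx
          subst hx
          rcases a with _ | a
          · exact ⟨0, b + 1, by simp, fun l ↦ by
              rw [BoundedContinuousFunction.mul_apply, BoundedContinuousFunction.star_apply, hc,
                hy, pow_succ]; ring⟩
          · obtain rfl : b = 0 := by simpa using hab
            exact ⟨a, 0, by simp, fun l ↦ by
              rw [BoundedContinuousFunction.mul_apply, BoundedContinuousFunction.star_apply, hc,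
                hy, pow_succ]
              linear_combination (l : ℂ) ^ a * hinv l⟩
    clear hg
    induction hg' using Submodule.span_induction with
    | mem g hg =>
      obtain ⟨a, b, hab, hg⟩ := hform g hg
      simp_rw [hg]
      rcases hab with rfl | rfl
      · have hconj (m : Measure UnitCircle) : ∫ l : UnitCircle, (l : ℂ) ^ 0 * star (l : ℂ) ^ b ∂m =
            star (∫ l : UnitCircle, (l : ℂ) ^ b ∂m) := by
          rw [Complex.star_def, ← integral_conj]
          simp
        rw [hconj, hconj, hpow]
      · simpa using hpow a
    | zero => simp
    | add f g _ _ hf hg =>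
      simp only [BoundedContinuousFunction.add_apply]
      rw [integral_add (f.integrable _) (g.integrable _),
        integral_add (f.integrable _) (g.integrable _), hf, hg]
    | smul a f _ hf =>
      simp only [BoundedContinuousFunction.smul_apply]
      rw [integral_smul, integral_smul, hf]

/-- A signed measure on the circle is determined by its Poisson integral. -/
theorem signedMeasure_eq_zero_of_poisson {s : SignedMeasure UnitCircle}
    (h : ∀ z : ℂ, ‖z‖ < 1 → ∫ᵛ l : UnitCircle, poissonKernel 0 z l ∂•s = 0) : s = 0 := by
  let j := s.toJordanDecomposition
  have hs : j.posPart.toSignedMeasure - j.negPart.toSignedMeasure = s :=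
    s.toSignedMeasure_toJordanDecomposition
  have key : j.posPart = j.negPart := by
    refine measure_ext_of_poisson fun z hz ↦ ?_
    have hi (m : Measure UnitCircle) [IsFiniteMeasure m] :
        m.toSignedMeasure.Integrable (fun l : UnitCircle ↦ poissonKernel 0 z l) := by
      rw [VectorMeasure.Integrable, Measure.variation_toSignedMeasure]
      exact integrable_of_continuous (continuous_poissonKernel hz)
    have := h z hz
    rw [← hs, VectorMeasure.integral_sub_vectorMeasure (hi _) (hi _),
      integral_smul_toSignedMeasure, integral_smul_toSignedMeasure] at this
    exact sub_eq_zero.mp this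
  rw [← hs]
  simp only [key, sub_self]

theorem vectorMeasure_integrable_of_continuous {F : Type*} [NormedAddCommGroup F]
    [NormedSpace ℝ F] [FiniteDimensional ℝ F] (ν : VectorMeasure UnitCircle F) {f : UnitCircle → ℝ}
    (hf : Continuous f) : ν.Integrable f := by
  have := isFiniteMeasure_variation ν
  exact integrable_of_continuous hf

/-- A vector measure on the circle with values in a finite-dimensional space is determined by its
Poisson integral. -/
theorem vectorMeasure_ext_of_poisson {F : Type*} [NormedAddCommGroup F]
    [NormedSpace ℝ F] [FiniteDimensional ℝ F] {ν₁ ν₂ : VectorMeasure UnitCircle F}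
    (h : ∀ z : ℂ, ‖z‖ < 1 → ∫ᵛ l : UnitCircle, poissonKernel 0 z l ∂•ν₁ =
      ∫ᵛ l : UnitCircle, poissonKernel 0 z l ∂•ν₂) : ν₁ = ν₂ := by
  have : CompleteSpace F := FiniteDimensional.complete ℝ F
  rw [← sub_eq_zero]
  ext E hE
  refine SeparatingDual.eq_zero_of_forall_dual_eq_zero (R := ℝ) fun ℓ ↦ ?_
  have h0 : mapCLM (ν₁ - ν₂) ℓ = 0 := by
    refine signedMeasure_eq_zero_of_poisson fun z hz ↦ ?_
    have hi (ν : VectorMeasure UnitCircle F) :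
        ν.Integrable (fun l : UnitCircle ↦ poissonKernel 0 z l) :=
      vectorMeasure_integrable_of_continuous ν (continuous_poissonKernel hz)
    rw [← clm_integral_smul _ _ (hi _), VectorMeasure.integral_sub_vectorMeasure (hi _) (hi _),
      h z hz, sub_self, map_zero]
  rw [← mapCLM_apply, h0]
  rfl

/-! ### Existence in the scalar Herglotz representation -/

/-- The point of the unit circle with angle `θ`. -/
noncomputable def circlePoint (θ : ℝ) : UnitCircle := ⟨circleMap 0 1 θ, by simp⟩

theorem coe_circlePoint (θ : ℝ) : (circlePoint θ : ℂ) = circleMap 0 1 θ := rfl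

theorem continuous_circlePoint : Continuous circlePoint :=
  Continuous.subtype_mk (continuous_circleMap 0 1) _

/-- The measure is `u dθ / 2π` on one period, pushed forward to the circle. -/
theorem exists_measure_integral_eq_circleAverage {u : ℂ → ℝ}
    (hu : ContinuousOn u (Metric.sphere 0 1)) (hu0 : ∀ z ∈ Metric.sphere (0 : ℂ) 1, 0 ≤ u z) :
    ∃ m : FiniteMeasure UnitCircle, ∀ φ : ℂ → ℝ, (Continuous fun l : UnitCircle ↦ φ l) →
      ∫ l : UnitCircle, φ l ∂(m : Measure UnitCircle) =
        Real.circleAverage (fun z ↦ φ z * u z) 0 1 := by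
  have hs (θ : ℝ) : circleMap 0 1 θ ∈ Metric.sphere (0 : ℂ) 1 := circleMap_mem_sphere 0 (by simp) θ
  have hg : Continuous fun θ ↦ (2 * Real.pi)⁻¹ * u (circleMap 0 1 θ) :=
    continuous_const.mul (hu.comp_continuous (continuous_circleMap 0 1) hs)
  let g : ℝ → ENNReal := fun θ ↦ ENNReal.ofReal ((2 * Real.pi)⁻¹ * u (circleMap 0 1 θ))
  have hgm : Measurable g := ENNReal.measurable_ofReal.comp hg.measurable
  let m₀ : Measure ℝ := (volume.restrict (Set.Ioc 0 (2 * Real.pi))).withDensity g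
  have hi : Integrable (fun θ ↦ (2 * Real.pi)⁻¹ * u (circleMap 0 1 θ))
      (volume.restrict (Set.Ioc 0 (2 * Real.pi))) :=
    (hg.integrableOn_Icc).mono_set Set.Ioc_subset_Icc_self
  have hm₀ : IsFiniteMeasure m₀ := isFiniteMeasure_withDensity_ofReal hi.2
  refine ⟨⟨m₀.map circlePoint, inferInstance⟩, fun φ hφ ↦ ?_⟩
  rw [FiniteMeasure.toMeasure_mk, integral_map continuous_circlePoint.aemeasurable
    hφ.aestronglyMeasurable, integral_withDensity_eq_integral_toReal_smul
    hgm (by simp [g]), Real.circleAverage_def,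
    intervalIntegral.integral_of_le (by positivity), ← integral_smul]
  refine integral_congr_ae (Filter.Eventually.of_forall fun θ ↦ ?_)
  have : 0 ≤ (2 * Real.pi)⁻¹ * u (circleMap 0 1 θ) :=
    mul_nonneg (by positivity) (hu0 _ (hs θ))
  simp only [g, ENNReal.toReal_ofReal this, smul_eq_mul]
  change _ * φ (circleMap 0 1 θ) = _
  ring

/-- The dilate `z ↦ f (r z)` is analytic up to the boundary, so the Poisson formula holds with the
nonnegative density `Re f (r ω)`. -/
theorem exists_measure_poisson_dilation {f : ℂ → ℂ} (hf : DifferentiableOn ℂ f (Metric.ball 0 1))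
    (h0 : ∀ z ∈ Metric.ball (0 : ℂ) 1, 0 ≤ (f z).re) {r : ℝ} (hr0 : 0 ≤ r) (hr : r < 1) :
    ∃ m : FiniteMeasure UnitCircle, ∀ z : ℂ, ‖z‖ < 1 →
      ∫ l : UnitCircle, poissonKernel 0 z l ∂(m : Measure UnitCircle) = (f (r * z)).re := by
  have hball {z : ℂ} (hz : ‖z‖ ≤ 1) : (r : ℂ) * z ∈ Metric.ball (0 : ℂ) 1 := by
    rw [mem_ball_zero_iff, norm_mul, Complex.norm_real, Real.norm_of_nonneg hr0]
    nlinarith [norm_nonneg z]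
  have hd : DifferentiableOn ℂ (fun z ↦ f (r * z)) (Metric.closedBall 0 1) :=
    hf.comp (by fun_prop) fun z hz ↦ hball (by simpa using hz)
  have hdc : DiffContOnCl ℂ (fun z ↦ f (r * z)) (Metric.ball 0 1) := by
    refine DifferentiableOn.diffContOnCl ?_
    rwa [closure_ball _ one_ne_zero]
  have hcont : ContinuousOn (fun z : ℂ ↦ f (r * z)) (Metric.sphere 0 1) :=
    hd.continuousOn.mono Metric.sphere_subset_closedBall
  obtain ⟨m, hm⟩ := exists_measure_integral_eq_circleAverage (u := fun z ↦ (f (r * z)).re)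
    (Complex.continuous_re.comp_continuousOn hcont)
    fun z hz ↦ h0 _ (hball (by simpa using (mem_sphere_zero_iff_norm.mp hz).le))
  refine ⟨m, fun z hz ↦ ?_⟩
  have h6 := hdc.circleAverage_poissonKernel_smul (w := z) (by simpa using hz)
  have h7 := hm (poissonKernel 0 z) (continuous_poissonKernel hz)
  have h1 : Continuous fun θ ↦ poissonKernel 0 z (circleMap 0 1 θ) := by
    have h := (continuous_poissonKernel hz).comp continuous_circlePoint
    simpa only [Function.comp_def, coe_circlePoint] using h
  have h2 : Continuous fun θ ↦ f (r * circleMap 0 1 θ) :=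
    hcont.comp_continuous (continuous_circleMap 0 1) fun θ ↦
      circleMap_mem_sphere 0 zero_le_one θ
  have h3 : IntervalIntegrable (fun θ ↦ (poissonKernel 0 z (circleMap 0 1 θ) : ℂ) *
      f (r * circleMap 0 1 θ)) volume 0 (2 * Real.pi) :=
    ((Complex.continuous_ofReal.comp h1).mul h2).intervalIntegrable _ _
  have h4 : ∫ θ in 0..2 * Real.pi, poissonKernel 0 z (circleMap 0 1 θ) *
      (f (r * circleMap 0 1 θ)).re = (∫ θ in 0..2 * Real.pi,
        (poissonKernel 0 z (circleMap 0 1 θ) : ℂ) * f (r * circleMap 0 1 θ)).re := by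
    have h5 := Complex.reCLM.intervalIntegral_comp_comm h3
    simpa only [Complex.reCLM_apply, Complex.re_ofReal_mul] using h5
  rw [Real.circleAverage_def] at h6 h7
  rw [h7, h4, ← h6, Complex.smul_re]
  rfl

theorem poissonKernel_zero_unitCircle (l : UnitCircle) : poissonKernel 0 0 l = 1 := by
  simp [poissonKernel_unitCircle]

/-- The Herglotz representation: the real part of an analytic function on the disk is the Poisson
integral of a finite measure on the circle, if it is nonnegative. -/
theorem exists_measure_poisson {f : ℂ → ℂ} (hf : DifferentiableOn ℂ f (Metric.ball 0 1))
    (h0 : ∀ z ∈ Metric.ball (0 : ℂ) 1, 0 ≤ (f z).re) :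
    ∃ m : FiniteMeasure UnitCircle, ∀ z : ℂ, ‖z‖ < 1 →
      ∫ l : UnitCircle, poissonKernel 0 z l ∂(m : Measure UnitCircle) = (f z).re := by
  let r : ℕ → ℝ := fun k ↦ k / (k + 1)
  have hr0 (k : ℕ) : 0 ≤ r k := by positivity
  have hr (k : ℕ) : r k < 1 := by
    rw [div_lt_one (by positivity)]
    exact lt_add_one _
  have hlim : Filter.Tendsto r Filter.atTop (𝓝 1) := tendsto_natCast_div_add_atTop 1
  choose m hm using fun k ↦ exists_measure_poisson_dilation hf h0 (hr0 k) (hr k)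
  have hmass (k : ℕ) : (m k).mass ≤ ((f 0).re).toNNReal := by
    have h := hm k 0 (by simp)
    simp only [poissonKernel_zero_unitCircle, integral_const, smul_eq_mul, mul_one, mul_zero] at h
    rw [← h]
    exact (Real.toNNReal_coe (r := (m k).mass)).ge
  -- The kernel with pole `0` is `1`, so all these measures have mass `Re f(0)` and lie in a weakly
  -- compact set. A limit along an ultrafilter replaces the choice of a subsequence.
  obtain ⟨m', -, hm'⟩ := (isCompact_setOfPred_finiteMeasure_le_of_compactSpace UnitCircle
    ((f 0).re).toNNReal).ultrafilter_le_nhds ((Filter.hyperfilter ℕ).map m)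
    (Filter.le_principal_iff.mpr (Filter.Eventually.of_forall (p := fun k ↦ m k ∈ _) hmass))
  refine ⟨m', fun z hz ↦ ?_⟩
  have h1 := FiniteMeasure.tendsto_iff_forall_integral_tendsto.mp
    (show Filter.Tendsto m (Filter.hyperfilter ℕ) (𝓝 m') from hm')
    (BoundedContinuousFunction.mkOfCompact ⟨_, continuous_poissonKernel hz⟩)
  refine tendsto_nhds_unique h1 ?_
  simp only [BoundedContinuousFunction.mkOfCompact_apply, ContinuousMap.coe_mk]
  simp_rw [fun k ↦ hm k z hz]
  have h2 : Filter.Tendsto (fun k ↦ (r k : ℂ) * z) Filter.atTop (𝓝 z) := by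
    have := (Complex.continuous_ofReal.tendsto 1).comp hlim
    simpa using this.mul_const z
  have hz' : Metric.ball (0 : ℂ) 1 ∈ 𝓝 z := Metric.isOpen_ball.mem_nhds (by simpa using hz)
  have h3 := (Complex.continuous_re.tendsto _).comp
    ((hf.differentiableAt hz').continuousAt.tendsto.comp h2)
  exact h3.mono_left Nat.hyperfilter_le_atTop

/-! ### Integrals of the Herglotz kernel -/

theorem one_sub_norm_le_norm_sub (l : UnitCircle) (z : ℂ) : 1 - ‖z‖ ≤ ‖(l : ℂ) - z‖ := by
  have := norm_sub_norm_le (l : ℂ) z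
  rwa [norm_unitCircle] at this

theorem continuous_herglotz_kernel {z : ℂ} (hz : ‖z‖ < 1) :
    Continuous fun l : UnitCircle ↦ ((l : ℂ) + z) / (l - z) :=
  Continuous.div (by fun_prop) (by fun_prop) fun l ↦ unitCircle_sub_ne_zero l hz

theorem differentiableOn_integral_herglotz_kernel (m : Measure UnitCircle) [IsFiniteMeasure m] :
    DifferentiableOn ℂ (fun z ↦ ∫ l : UnitCircle, ((l : ℂ) + z) / (l - z) ∂m)
      (Metric.ball 0 1) := by
  intro z₀ hz₀
  have hz₀ : ‖z₀‖ < 1 := by simpa using hz₀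
  obtain ⟨ρ, hρ0, hρ⟩ := exists_between hz₀
  have hball {z : ℂ} (hz : z ∈ Metric.ball (0 : ℂ) ρ) : ‖z‖ < 1 :=
    (mem_ball_zero_iff.mp hz).trans hρ
  have hmem : Metric.ball (0 : ℂ) ρ ∈ 𝓝 z₀ := Metric.isOpen_ball.mem_nhds (by simpa using hρ0)
  refine (hasDerivAt_integral_of_dominated_loc_of_deriv_le (s := Metric.ball 0 ρ)
    (bound := fun _ ↦ 2 / (1 - ρ) ^ 2) (F' := fun z (l : UnitCircle) ↦ 2 * (l : ℂ) / (l - z) ^ 2)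
    hmem ?_ (integrable_of_continuous (continuous_herglotz_kernel hz₀)) ?_ ?_
    (integrable_const _) ?_).2.differentiableAt.differentiableWithinAt
  · filter_upwards [hmem] with z hz
    exact (continuous_herglotz_kernel (hball hz)).aestronglyMeasurable
  · refine (Continuous.div (by fun_prop) (by fun_prop) fun l ↦ ?_).aestronglyMeasurable
    exact pow_ne_zero _ (unitCircle_sub_ne_zero l hz₀)
  · refine Filter.Eventually.of_forall fun l z hz ↦ ?_
    have h1 : 0 < 1 - ρ := sub_pos.mpr hρ
    have h2 : 1 - ρ ≤ ‖(l : ℂ) - z‖ :=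
      (sub_le_sub_left (mem_ball_zero_iff.mp hz).le 1).trans (one_sub_norm_le_norm_sub l z)
    rw [norm_div, norm_mul, norm_unitCircle, norm_pow, mul_one, RCLike.norm_ofNat]
    gcongr
  · refine Filter.Eventually.of_forall fun l z hz ↦ ?_
    have h0 := unitCircle_sub_ne_zero l (hball hz)
    have h := ((hasDerivAt_id z).const_add (l : ℂ)).div ((hasDerivAt_id z).const_sub (l : ℂ)) h0
    refine h.congr_deriv ?_
    change (1 * ((l : ℂ) - z) - (l + z) * -1) / ((l : ℂ) - z) ^ 2 = _
    ring

/-- The difference of the two sides is analytic with vanishing real part on the connected disk,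
hence constant. -/
theorem exists_eq_integral_herglotz_kernel_add_const {f : ℂ → ℂ}
    (hf : DifferentiableOn ℂ f (Metric.ball 0 1)) (m : Measure UnitCircle) [IsFiniteMeasure m]
    (hm : ∀ z : ℂ, ‖z‖ < 1 → ∫ l : UnitCircle, poissonKernel 0 z l ∂m = (f z).re) :
    ∃ c : ℂ, ∀ z : ℂ, ‖z‖ < 1 → f z = (∫ l : UnitCircle, ((l : ℂ) + z) / (l - z) ∂m) + c := by
  have hd := hf.sub (differentiableOn_integral_herglotz_kernel m)
  obtain ⟨c, hc⟩ := (hd.analyticOnNhd Metric.isOpen_ball).eq_const_of_re_eq_const (c₀ := 0)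
    (fun z hz ↦ by
      have hz : ‖z‖ < 1 := by simpa using hz
      have h1 := Complex.reCLM.integral_comp_comm
        (integrable_of_continuous (m := m) (continuous_herglotz_kernel hz))
      simp only [Complex.reCLM_apply, re_herglotz_kernel] at h1
      rw [Pi.sub_apply, Complex.sub_re, ← h1, hm z hz, sub_self])
    Metric.isOpen_ball
    ((convex_ball (0 : ℂ) 1).isConnected ⟨0, by simp⟩)
  refine ⟨c, fun z hz ↦ ?_⟩
  rw [← hc z (by simpa using hz), Pi.sub_apply, add_sub_cancel]

/-! ### The Cayley transform and scalar non-tangential limits -/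

theorem add_I_ne_zero {w : ℂ} (hw : 0 ≤ w.im) : w + Complex.I ≠ 0 := by
  intro h
  have := congrArg Complex.im h
  simp at this
  linarith

theorem one_sub_norm_cayley_sq {w : ℂ} (hw : 0 ≤ w.im) :
    1 - ‖cayley w‖ ^ 2 = 4 * w.im / ‖w + Complex.I‖ ^ 2 := by
  have h0 : ‖w + Complex.I‖ ^ 2 ≠ 0 := by
    have := add_I_ne_zero hw
    positivity
  rw [cayley, norm_div, div_pow, eq_div_iff h0, sub_mul, div_mul_cancel₀ _ h0]
  rw [Complex.sq_norm, Complex.sq_norm, Complex.normSq_apply, Complex.normSq_apply]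
  simp
  ring

theorem norm_cayley_lt_one {w : ℂ} (hw : 0 < w.im) : ‖cayley w‖ < 1 := by
  have h1 := one_sub_norm_cayley_sq hw.le
  have h2 := add_I_ne_zero hw.le
  have : 0 < 1 - ‖cayley w‖ ^ 2 := by rw [h1]; positivity
  nlinarith [norm_nonneg (cayley w)]

theorem continuousAt_cayley {w : ℂ} (hw : 0 ≤ w.im) : ContinuousAt cayley w :=
  ContinuousAt.div (by fun_prop) (by fun_prop) (add_I_ne_zero hw)

theorem cayley_sub_cayley {a b : ℂ} (ha : 0 ≤ a.im) (hb : 0 ≤ b.im) :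
    cayley a - cayley b = 2 * Complex.I * (a - b) / ((a + Complex.I) * (b + Complex.I)) := by
  have h1 := add_I_ne_zero ha
  have h2 := add_I_ne_zero hb
  rw [cayley, cayley]
  field_simp
  ring

/-- In the region, `|s - w| ≤ (κ + 1) Im w`, while `|l - γ(w)| ≥ (1 - |γ(w)|²)/2 = 2 Im w / |w +
i|²`. The factors `Im w` cancel, leaving a bound uniform in `l`; this is where non-tangential
approach is needed. -/
theorem norm_mul_herglotz_kernel_cayley_le (l : UnitCircle) {s κ : ℝ} {w : ℂ} (hw : 0 < w.im)
    (hκ : |w.re - s| ≤ κ * w.im) :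
    ‖((s : ℂ) - w) * (((l : ℂ) + cayley w) / (l - cayley w))‖ ≤
      (κ + 1) * ‖w + Complex.I‖ ^ 2 := by
  have h0 := add_I_ne_zero hw.le
  have h1 := one_sub_norm_cayley_sq hw.le
  have h2 := norm_cayley_lt_one hw
  have h3 := one_sub_norm_le_norm_sub l (cayley w)
  have h4 : 2 * w.im / ‖w + Complex.I‖ ^ 2 ≤ ‖(l : ℂ) - cayley w‖ := by
    have : 2 * w.im / ‖w + Complex.I‖ ^ 2 = (1 - ‖cayley w‖ ^ 2) / 2 := by rw [h1]; ring
    rw [this]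
    nlinarith [norm_nonneg (cayley w)]
  have h5 : ‖(l : ℂ) + cayley w‖ ≤ 2 := by
    refine (norm_add_le _ _).trans ?_
    rw [norm_unitCircle]
    linarith
  have h6 : ‖(s : ℂ) - w‖ ≤ (κ + 1) * w.im := by
    refine (Complex.norm_le_abs_re_add_abs_im _).trans ?_
    simp only [Complex.sub_re, Complex.sub_im, Complex.ofReal_re, Complex.ofReal_im, zero_sub,
      abs_neg, abs_of_pos hw, abs_sub_comm s]
    linarith
  rw [norm_mul, norm_div]
  calc _ ≤ ((κ + 1) * w.im) * (2 / (2 * w.im / ‖w + Complex.I‖ ^ 2)) := by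
        gcongr
        · exact (norm_nonneg _).trans h6
    _ = _ := by field_simp

/-- Integrals of the Herglotz kernel detect the point masses of the measure. -/
theorem tendsto_mul_integral_herglotz_kernel (m : Measure UnitCircle) [IsFiniteMeasure m]
    (s κ : ℝ) :
    Filter.Tendsto
      (fun w ↦ ((s : ℂ) - w) * ∫ l : UnitCircle, ((l : ℂ) + cayley w) / (l - cayley w) ∂m)
      (𝓝[{w : ℂ | 0 < w.im ∧ |w.re - s| ≤ κ * w.im}] (s : ℂ))
      (𝓝 (-Complex.I * (1 + (s : ℂ) ^ 2) * m.real {l : UnitCircle | (l : ℂ) = cayley s})) := by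
  have hs : (0 : ℝ) ≤ (s : ℂ).im := by simp
  have hset : MeasurableSet {l : UnitCircle | (l : ℂ) = cayley s} :=
    measurableSet_eq_fun measurable_subtype_coe measurable_const
  have hcay : ContinuousAt cayley (s : ℂ) := continuousAt_cayley hs
  have hreg : ∀ᶠ w in 𝓝[{w : ℂ | 0 < w.im ∧ |w.re - s| ≤ κ * w.im}] (s : ℂ),
      0 < w.im ∧ |w.re - s| ≤ κ * w.im := self_mem_nhdsWithin
  have key := tendsto_integral_filter_of_norm_le_const (μ := m)
    (l := 𝓝[{w : ℂ | 0 < w.im ∧ |w.re - s| ≤ κ * w.im}] (s : ℂ))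
    (F := fun w (l : UnitCircle) ↦ ((s : ℂ) - w) * (((l : ℂ) + cayley w) / (l - cayley w)))
    (f := {l : UnitCircle | (l : ℂ) = cayley s}.indicator
      fun _ ↦ -Complex.I * (1 + (s : ℂ) ^ 2)) ?_ ?_ ?_
  · rw [integral_indicator_const _ hset, Complex.real_smul, mul_comm] at key
    simpa only [integral_const_mul] using key
  · filter_upwards [hreg] with w hw
    exact ((continuous_herglotz_kernel (norm_cayley_lt_one hw.1)).aestronglyMeasurable).const_mul _
  · have hc : ContinuousAt (fun w : ℂ ↦ (κ + 1) * ‖w + Complex.I‖ ^ 2) (s : ℂ) := by fun_prop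
    refine ⟨(κ + 1) * ‖(s : ℂ) + Complex.I‖ ^ 2 + 1, ?_⟩
    have h1 := (hc.eventually (gt_mem_nhds (lt_add_one _))).filter_mono
      (nhdsWithin_le_nhds (s := {w : ℂ | 0 < w.im ∧ |w.re - s| ≤ κ * w.im}))
    filter_upwards [h1, hreg] with w hw1 hw2
    exact Filter.Eventually.of_forall fun l ↦
      (norm_mul_herglotz_kernel_cayley_le l hw2.1 hw2.2).trans hw1.le
  -- At `l = γ(s)` the denominator `γ(s) - γ(w)` has a factor `s - w` that cancels the one in front.
  -- At any other `l` the kernel is continuous at `w = s`, and the factor `s - w` forces the limit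
  -- `0`.
  · refine Filter.Eventually.of_forall fun l ↦ ?_
    by_cases hl : (l : ℂ) = cayley s
    · rw [Set.indicator_of_mem (by exact hl)]
      have hI := add_I_ne_zero hs
      have hval : ((s : ℂ) + Complex.I) * (s + Complex.I) / (2 * Complex.I) *
          (l + cayley s) = -Complex.I * (1 + (s : ℂ) ^ 2) := by
        rw [hl, cayley]
        field_simp
        linear_combination 2 * (s : ℂ) ^ 2 * Complex.I_sq
      rw [← hval]
      have hc : ContinuousAt (fun w : ℂ ↦ ((s : ℂ) + Complex.I) * (w + Complex.I) /
          (2 * Complex.I) * (l + cayley w)) (s : ℂ) := by fun_prop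
      refine (hc.tendsto.mono_left nhdsWithin_le_nhds).congr' ?_
      filter_upwards [hreg] with w hw
      have h1 := add_I_ne_zero hw.1.le
      have h2 : (s : ℂ) - w ≠ 0 := by
        intro h
        have := congrArg Complex.im h
        simp at this
        exact hw.1.ne' this
      rw [hl, cayley_sub_cayley hs hw.1.le]
      field_simp
    · rw [Set.indicator_of_notMem (by exact hl)]
      have hne : (l : ℂ) - cayley s ≠ 0 := sub_ne_zero.mpr hl
      have hc : ContinuousAt (fun w : ℂ ↦ ((s : ℂ) - w) * (((l : ℂ) + cayley w) /
          (l - cayley w))) (s : ℂ) := by fun_prop (disch := exact hne)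
      have := hc.tendsto.mono_left
        (nhdsWithin_le_nhds (s := {w : ℂ | 0 < w.im ∧ |w.re - s| ≤ κ * w.im}))
      simpa only [sub_self, zero_mul] using this

theorem tendsto_mul_comp_cayley {f : ℂ → ℂ}
    (hf : DifferentiableOn ℂ f (Metric.ball 0 1)) (m : Measure UnitCircle) [IsFiniteMeasure m]
    (hm : ∀ z : ℂ, ‖z‖ < 1 → ∫ l : UnitCircle, poissonKernel 0 z l ∂m = (f z).re) (s κ : ℝ) :
    Filter.Tendsto (fun w ↦ ((s : ℂ) - w) * f (cayley w))
      (𝓝[{w : ℂ | 0 < w.im ∧ |w.re - s| ≤ κ * w.im}] (s : ℂ))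
      (𝓝 (-Complex.I * (1 + (s : ℂ) ^ 2) * m.real {l : UnitCircle | (l : ℂ) = cayley s})) := by
  obtain ⟨c, hc⟩ := exists_eq_integral_herglotz_kernel_add_const hf m hm
  have h1 : Filter.Tendsto (fun w : ℂ ↦ ((s : ℂ) - w) * c)
      (𝓝[{w : ℂ | 0 < w.im ∧ |w.re - s| ≤ κ * w.im}] (s : ℂ)) (𝓝 0) := by
    have : ContinuousAt (fun w : ℂ ↦ ((s : ℂ) - w) * c) (s : ℂ) := by fun_prop
    have := this.tendsto.mono_left
      (nhdsWithin_le_nhds (s := {w : ℂ | 0 < w.im ∧ |w.re - s| ≤ κ * w.im}))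
    simpa only [sub_self, zero_mul] using this
  have h2 := (tendsto_mul_integral_herglotz_kernel m s κ).add h1
  rw [add_zero] at h2
  refine h2.congr' ?_
  filter_upwards [self_mem_nhdsWithin] with w hw
  rw [hc _ (norm_cayley_lt_one hw.1), mul_add]

/-! ### Quadratic forms, polarization and the matrix Herglotz representation -/

variable {n : ℕ}

/-- The quadratic form `A ↦ v* A v`, as a linear functional of the matrix. -/
noncomputable def quadForm (v : Fin n → ℂ) : Matrix (Fin n) (Fin n) ℂ →L[ℂ] ℂ :=
  LinearMap.toContinuousLinearMap
    { toFun := fun A ↦ star v ⬝ᵥ A *ᵥ v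
      map_add' := fun A B ↦ by rw [Matrix.add_mulVec, dotProduct_add]
      map_smul' := fun c A ↦ by rw [Matrix.smul_mulVec, dotProduct_smul, RingHom.id_apply] }

theorem quadForm_apply (v : Fin n → ℂ) (A : Matrix (Fin n) (Fin n) ℂ) :
    quadForm v A = star v ⬝ᵥ A *ᵥ v := rfl

/-- The real part of the quadratic form `A ↦ v* A v`. -/
noncomputable def quadRe (v : Fin n → ℂ) : Matrix (Fin n) (Fin n) ℂ →L[ℝ] ℝ :=
  Complex.reCLM.comp ((quadForm v).restrictScalars ℝ)

theorem quadRe_apply (v : Fin n → ℂ) (A : Matrix (Fin n) (Fin n) ℂ) :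
    quadRe v A = (quadForm v A).re := rfl

theorem quadForm_conjTranspose (v : Fin n → ℂ) (A : Matrix (Fin n) (Fin n) ℂ) :
    quadForm v Aᴴ = star (quadForm v A) := by
  rw [quadForm_apply, quadForm_apply, Matrix.star_dotProduct, Matrix.star_mulVec,
    Matrix.conjTranspose_conjTranspose, Matrix.dotProduct_mulVec]

theorem ofReal_quadRe (v : Fin n → ℂ) {A : Matrix (Fin n) (Fin n) ℂ} (hA : A.IsHermitian) :
    (quadRe v A : ℂ) = quadForm v A := by
  rw [quadRe_apply]
  refine Complex.conj_eq_iff_re.mp ?_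
  have := quadForm_conjTranspose v A
  rw [hA.eq] at this
  exact this.symm

theorem quadRe_hermitianPart (v : Fin n → ℂ) (A : Matrix (Fin n) (Fin n) ℂ) :
    quadRe v ((2⁻¹ : ℂ) • (A + Aᴴ)) = (quadForm v A).re := by
  rw [quadRe_apply, map_smul, map_add, quadForm_conjTranspose, Complex.star_def,
    Complex.add_conj, smul_eq_mul]
  simp

/-- The index set, the vectors and the matrices of the polarization identity. -/
abbrev PolIndex (n : ℕ) : Type := (Fin n × Fin n) × Fin 4

noncomputable def polVec (a : PolIndex n) : Fin n → ℂ :=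
  Pi.single a.1.2 1 + Complex.I ^ (a.2 : ℕ) • Pi.single a.1.1 1

noncomputable def polMat (a : PolIndex n) : Matrix (Fin n) (Fin n) ℂ :=
  (Complex.I ^ (a.2 : ℕ) / 4) • Matrix.single a.1.1 a.1.2 1

theorem quadForm_single_add (A : Matrix (Fin n) (Fin n) ℂ) (i j : Fin n) (c : ℂ) :
    quadForm (Pi.single j 1 + c • Pi.single i 1) A =
      A j j + c * A j i + star c * A i j + star c * c * A i i := by
  rw [quadForm_apply]
  simp only [star_add, star_smul, Matrix.mulVec_add, Matrix.mulVec_smul, dotProduct_add,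
    add_dotProduct, smul_dotProduct, dotProduct_smul, ← Pi.single_star, star_one,
    single_one_dotProduct, Matrix.mulVec_single_one, Matrix.col_apply, smul_eq_mul]
  ring

/-- Polarization: weighting the form at `e_j + i^k e_i` by `i^k / 4` and summing over `k` kills
every term except `A i j`. It carries scalar facts about all `v* A v` over to the matrix itself. -/
theorem sum_quadForm_smul_polMat (A : Matrix (Fin n) (Fin n) ℂ) :
    ∑ a : PolIndex n, quadForm (polVec a) A • polMat a = A := by
  rw [Fintype.sum_prod_type]
  conv_rhs => rw [Matrix.matrix_eq_sum_single A, ← Fintype.sum_prod_type']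
  refine Finset.sum_congr rfl fun p _ ↦ ?_
  have h3 : Complex.I ^ 3 = -Complex.I := Complex.I_pow_three
  simp only [polVec, polMat, Fin.sum_univ_four, quadForm_single_add, smul_smul, ← add_smul,
    Fin.val_zero, Fin.val_one, Fin.val_two]
  have : A p.1 p.2 • Matrix.single p.1 p.2 (1 : ℂ) = Matrix.single p.1 p.2 (A p.1 p.2) := by
    rw [Matrix.smul_single, smul_eq_mul, mul_one]
  rw [← this]
  congr 1
  have h4 : ((3 : Fin 4) : ℕ) = 3 := rfl
  simp only [h4, h3, pow_zero, pow_one, Complex.I_sq, Complex.star_def, map_one, map_neg,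
    Complex.conj_I]
  linear_combination ((A p.2 p.1 - A p.1 p.2) / 2) * Complex.I_sq

theorem star_dotProduct_self_eq_norm_sq (x : Fin n → ℂ) :
    star x ⬝ᵥ x = ((‖WithLp.toLp 2 x‖ ^ 2 : ℝ) : ℂ) := by
  rw [EuclideanSpace.norm_sq_eq, dotProduct, Complex.ofReal_sum]
  refine Finset.sum_congr rfl fun i _ ↦ ?_
  simp [Complex.conj_mul']

/-- With `v = (1 - C) x` the real part becomes `‖x‖² - ‖C x‖²`. -/
theorem re_quadForm_cayley_nonneg {C : Matrix (Fin n) (Fin n) ℂ} (hC : ‖C‖ ≤ 1)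
    (hu : IsUnit (1 - C)) (v : Fin n → ℂ) :
    0 ≤ (quadForm v ((1 - C)⁻¹ * (1 + C))).re := by
  have hdet : IsUnit (1 - C).det := (Matrix.isUnit_iff_isUnit_det _).mp hu
  obtain ⟨x, rfl⟩ : ∃ x, v = (1 - C) *ᵥ x :=
    ⟨(1 - C)⁻¹ *ᵥ v, by rw [Matrix.mulVec_mulVec, Matrix.mul_nonsing_inv _ hdet,
      Matrix.one_mulVec]⟩
  have hcomm : (1 + C) * (1 - C) = (1 - C) * (1 + C) := by noncomm_ring
  have h1 : ((1 - C)⁻¹ * (1 + C)) *ᵥ ((1 - C) *ᵥ x) = (1 + C) *ᵥ x := by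
    rw [Matrix.mulVec_mulVec, mul_assoc, hcomm, ← mul_assoc, Matrix.nonsing_inv_mul _ hdet,
      one_mul]
  rw [quadForm_apply, h1, Matrix.sub_mulVec, Matrix.add_mulVec, Matrix.one_mulVec, star_sub,
    sub_dotProduct, dotProduct_add, dotProduct_add, star_dotProduct_self_eq_norm_sq,
    star_dotProduct_self_eq_norm_sq]
  have h2 : (star (C *ᵥ x) ⬝ᵥ x).re = (star x ⬝ᵥ C *ᵥ x).re := by
    have : star (C *ᵥ x) ⬝ᵥ x = star (star x ⬝ᵥ C *ᵥ x) := by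
      rw [Matrix.star_dotProduct]
    rw [this, Complex.star_def, Complex.conj_re]
  have h3 : ‖WithLp.toLp 2 (C *ᵥ x)‖ ≤ ‖WithLp.toLp 2 x‖ := by
    refine (Matrix.l2_opNorm_mulVec C (WithLp.toLp 2 x)).trans ?_
    exact mul_le_of_le_one_left (norm_nonneg _) hC
  simp only [Complex.sub_re, Complex.add_re, Complex.ofReal_re, h2]
  have := pow_le_pow_left₀ (norm_nonneg _) h3 2
  linarith

theorem integral_smul_finset_sum_mapCLM {ι F : Type*} [Fintype ι] [NormedAddCommGroup F]
    [NormedSpace ℝ F] [FiniteDimensional ℝ F] (m : ι → FiniteMeasure UnitCircle) (M : ι → F)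
    {f : UnitCircle → ℝ} (hf : Continuous f) :
    ∫ᵛ l, f l ∂•(∑ a, mapCLM (m a : Measure UnitCircle).toSignedMeasure
      (ContinuousLinearMap.toSpanSingleton ℝ (M a))) =
      ∑ a, (∫ l, f l ∂(m a : Measure UnitCircle)) • M a := by
  have : CompleteSpace F := FiniteDimensional.complete ℝ F
  rw [VectorMeasure.integral_finsetSum_vectorMeasure
    fun a _ ↦ vectorMeasure_integrable_of_continuous _ hf]
  refine Finset.sum_congr rfl fun a _ ↦ ?_
  rw [← clm_integral_smul _ _ (vectorMeasure_integrable_of_continuous _ hf),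
    integral_smul_toSignedMeasure, ContinuousLinearMap.toSpanSingleton_apply]

theorem isHermitian_hermitianPart (A : Matrix (Fin n) (Fin n) ℂ) :
    ((2⁻¹ : ℂ) • (A + Aᴴ)).IsHermitian := by
  rw [Matrix.IsHermitian, Matrix.conjTranspose_smul, Matrix.conjTranspose_add,
    Matrix.conjTranspose_conjTranspose, add_comm]
  simp

/-- The Herglotz representation of matrix functions with nonnegative real part. -/
theorem exists_vectorMeasure_poisson {H : ℂ → Matrix (Fin n) (Fin n) ℂ}
    (hd : DifferentiableOn ℂ H (Metric.ball 0 1))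
    (hpos : ∀ z ∈ Metric.ball (0 : ℂ) 1, ∀ v, 0 ≤ (quadForm v (H z)).re) :
    ∃ ν : VectorMeasure UnitCircle (Matrix (Fin n) (Fin n) ℂ),
      (∀ E, MeasurableSet E → (ν E).PosSemidef) ∧ ∀ z : ℂ, ‖z‖ < 1 →
        (2⁻¹ : ℂ) • (H z + (H z)ᴴ) = ∫ᵛ l : UnitCircle, poissonKernel 0 z l ∂•ν := by
  have hq (v : Fin n → ℂ) : DifferentiableOn ℂ (fun z ↦ quadForm v (H z)) (Metric.ball 0 1) :=
    (quadForm v).differentiable.comp_differentiableOn hd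
  choose m hm using fun v ↦ exists_measure_poisson (hq v) fun z hz ↦ hpos z hz v
  let ν : VectorMeasure UnitCircle (Matrix (Fin n) (Fin n) ℂ) :=
    ∑ a : PolIndex n, mapCLM (m (polVec a) : Measure UnitCircle).toSignedMeasure
      (ContinuousLinearMap.toSpanSingleton ℝ (polMat a))
  have hν (z : ℂ) (hz : ‖z‖ < 1) :
      (2⁻¹ : ℂ) • (H z + (H z)ᴴ) = ∫ᵛ l : UnitCircle, poissonKernel 0 z l ∂•ν := by
    rw [integral_smul_finset_sum_mapCLM _ _ (continuous_poissonKernel hz)]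
    conv_lhs => rw [← sum_quadForm_smul_polMat ((2⁻¹ : ℂ) • (H z + (H z)ᴴ))]
    refine Finset.sum_congr rfl fun a _ ↦ ?_
    rw [← ofReal_quadRe _ (isHermitian_hermitianPart _), quadRe_hermitianPart, hm _ z hz,
      Complex.coe_smul]
  have hint (z : ℂ) (hz : ‖z‖ < 1) : ν.Integrable fun l : UnitCircle ↦ poissonKernel 0 z l :=
    vectorMeasure_integrable_of_continuous ν (continuous_poissonKernel hz)
  refine ⟨ν, fun E hE ↦ ?_, hν⟩
  -- By construction `ν` only involves the measures of the polarization vectors. Uniqueness of the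
  -- Poisson representation identifies `v* ν v` with `m v` for every `v`, which gives positivity.
  have hre (v : Fin n → ℂ) :
      mapCLM ν (quadRe v) = (m v : Measure UnitCircle).toSignedMeasure := by
    refine vectorMeasure_ext_of_poisson fun z hz ↦ ?_
    rw [← clm_integral_smul _ _ (hint z hz), ← hν z hz, quadRe_hermitianPart,
      integral_smul_toSignedMeasure, hm v z hz]
  have him (v : Fin n → ℂ) :
      mapCLM ν (Complex.imCLM.comp ((quadForm v).restrictScalars ℝ)) = 0 := by
    refine vectorMeasure_ext_of_poisson fun z hz ↦ ?_
    rw [← clm_integral_smul _ _ (hint z hz), ← hν z hz,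
      VectorMeasure.integral_zero_vectorMeasure]
    change (quadForm v _).im = 0
    rw [← ofReal_quadRe _ (isHermitian_hermitianPart _), Complex.ofReal_im]
  have hform (v : Fin n → ℂ) : 0 ≤ quadForm v (ν E) := by
    rw [Complex.nonneg_iff]
    constructor
    · have h : (quadForm v (ν E)).re = (m v : Measure UnitCircle).toSignedMeasure E := by
        rw [← hre v]
        rfl
      rw [h, Measure.toSignedMeasure_apply_measurable hE]
      exact measureReal_nonneg
    · change 0 = mapCLM ν (Complex.imCLM.comp ((quadForm v).restrictScalars ℝ)) E
      rw [him v]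
      rfl
  refine Matrix.PosSemidef.of_dotProduct_mulVec_nonneg ?_ hform
  -- A matrix whose quadratic form is real has the same form as its adjoint, so polarization
  -- identifies the two.
  rw [Matrix.IsHermitian, ← sum_quadForm_smul_polMat (ν E)ᴴ]
  conv_rhs => rw [← sum_quadForm_smul_polMat (ν E)]
  refine Finset.sum_congr rfl fun a _ ↦ ?_
  rw [quadForm_conjTranspose, Complex.star_def,
    Complex.conj_eq_iff_im.mpr (Complex.nonneg_iff.mp (hform _)).2.symm]

/-- The scalar measures `v* ν v` of a positive semidefinite matrix measure. -/
theorem exists_measure_toSignedMeasure_eq {ν : VectorMeasure UnitCircle (Matrix (Fin n) (Fin n) ℂ)}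
    (hν : ∀ E, MeasurableSet E → (ν E).PosSemidef) (v : Fin n → ℂ) :
    ∃ m : FiniteMeasure UnitCircle,
      (m : Measure UnitCircle).toSignedMeasure = mapCLM ν (quadRe v) := by
  have h : VectorMeasure.restrict 0 Set.univ ≤ (mapCLM ν (quadRe v)).restrict Set.univ := by
    rw [VectorMeasure.restrict_univ, VectorMeasure.restrict_univ]
    intro E hE
    have := (hν E hE).dotProduct_mulVec_nonneg v
    exact (Complex.nonneg_iff.mp this).1
  exact ⟨⟨SignedMeasure.toMeasureOfZeroLE _ Set.univ MeasurableSet.univ h, inferInstance⟩,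
    SignedMeasure.toMeasureOfZeroLE_toSignedMeasure _ h⟩

theorem tendsto_smul_comp_cayley {H : ℂ → Matrix (Fin n) (Fin n) ℂ}
    (hd : DifferentiableOn ℂ H (Metric.ball 0 1))
    {ν : VectorMeasure UnitCircle (Matrix (Fin n) (Fin n) ℂ)}
    (hν : ∀ E, MeasurableSet E → (ν E).PosSemidef)
    (hp : ∀ z : ℂ, ‖z‖ < 1 →
      (2⁻¹ : ℂ) • (H z + (H z)ᴴ) = ∫ᵛ l : UnitCircle, poissonKernel 0 z l ∂•ν) (s κ : ℝ) :
    Filter.Tendsto (fun w ↦ ((s : ℂ) - w) • H (cayley w))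
      (𝓝[{w : ℂ | 0 < w.im ∧ |w.re - s| ≤ κ * w.im}] (s : ℂ))
      (𝓝 ((-Complex.I * (1 + (s : ℂ) ^ 2)) • ν {l : UnitCircle | (l : ℂ) = cayley s})) := by
  have hset : MeasurableSet {l : UnitCircle | (l : ℂ) = cayley s} :=
    measurableSet_eq_fun measurable_subtype_coe measurable_const
  have hq (v : Fin n → ℂ) : Filter.Tendsto (fun w ↦ quadForm v (((s : ℂ) - w) • H (cayley w)))
      (𝓝[{w : ℂ | 0 < w.im ∧ |w.re - s| ≤ κ * w.im}] (s : ℂ))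
      (𝓝 (quadForm v ((-Complex.I * (1 + (s : ℂ) ^ 2)) •
        ν {l : UnitCircle | (l : ℂ) = cayley s}))) := by
    obtain ⟨m, hm⟩ := exists_measure_toSignedMeasure_eq hν v
    have h1 := tendsto_mul_comp_cayley (f := fun z ↦ quadForm v (H z))
      ((quadForm v).differentiable.comp_differentiableOn hd) (m : Measure UnitCircle)
      (fun z hz ↦ by
        rw [← integral_smul_toSignedMeasure, hm, ← clm_integral_smul _ _
          (vectorMeasure_integrable_of_continuous ν (continuous_poissonKernel hz)), ← hp z hz,
          quadRe_hermitianPart]) s κ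
    have h2 : ((m : Measure UnitCircle).real {l : UnitCircle | (l : ℂ) = cayley s} : ℂ) =
        quadForm v (ν {l : UnitCircle | (l : ℂ) = cayley s}) := by
      rw [← ofReal_quadRe v (hν _ hset).1, ← mapCLM_apply, ← hm,
        Measure.toSignedMeasure_apply_measurable hset]
    rw [h2] at h1
    simpa only [map_smul, smul_eq_mul] using h1
  -- The finitely many scalar limits at the polarization vectors recombine into the matrix limit.
  have h := tendsto_finsetSum (Finset.univ : Finset (PolIndex n))
    fun a _ ↦ (hq (polVec a)).smul_const (polMat a)
  simpa only [sum_quadForm_smul_polMat] using h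

/-! ### Transfer to the half-plane and the Clark measure -/

theorem im_cayleyInv_pos {z : ℂ} (hz : ‖z‖ < 1) : 0 < (cayleyInv z).im := by
  have h1 : (1 : ℂ) - z ≠ 0 := by
    intro h
    rw [← sub_eq_zero.mp h, norm_one] at hz
    exact lt_irrefl _ hz
  have h2 : 0 < Complex.normSq (1 - z) := Complex.normSq_pos.mpr h1
  have h3 : ‖z‖ ^ 2 < 1 := by nlinarith [norm_nonneg z]
  rw [Complex.sq_norm, Complex.normSq_apply] at h3
  have h4 : (cayleyInv z).im = (1 - (z.re * z.re + z.im * z.im)) / Complex.normSq (1 - z) := by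
    rw [cayleyInv, Complex.div_im, ← sub_div]
    congr 1
    simp
    ring
  rw [h4]
  exact div_pos (by linarith) h2

theorem cayleyInv_cayley {w : ℂ} (hw : 0 ≤ w.im) : cayleyInv (cayley w) = w := by
  have h1 := add_I_ne_zero hw
  have h2 : 1 - cayley w = 2 * Complex.I / (w + Complex.I) := by
    rw [cayley]
    field_simp
    ring
  have h3 : 1 + cayley w = 2 * w / (w + Complex.I) := by
    rw [cayley]
    field_simp
    ring
  rw [cayleyInv, h2, h3]
  field_simp

theorem differentiableOn_herglotz {C : ℂ → Matrix (Fin n) (Fin n) ℂ} {X : Set ℂ}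
    (hC : DifferentiableOn ℂ C X) (hu : ∀ z ∈ X, IsUnit (1 - C z)) :
    DifferentiableOn ℂ (herglotz C) X := by
  intro z hz
  have h1 : DifferentiableWithinAt ℂ (fun z ↦ 1 - C z) X z := (hC z hz).const_sub 1
  have h2 : DifferentiableAt ℂ Ring.inverse (1 - C z) :=
    differentiableAt_inverse (hu z hz)
  have h3 : DifferentiableWithinAt ℂ (fun z ↦ (1 - C z)⁻¹) X z := by
    simp only [Matrix.nonsing_inv_eq_ringInverse]
    exact h2.comp_differentiableWithinAt z h1
  exact h3.mul ((hC z hz).const_add 1)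

variable {B : ℂ → Matrix (Fin n) (Fin n) ℂ} {α : Matrix (Fin n) (Fin n) ℂ}

theorem differentiableOn_disk (hB : IsContractiveAnalytic upperHalf B) :
    DifferentiableOn ℂ (fun z ↦ B (cayleyInv z) * αᴴ) (Metric.ball 0 1) := by
  have h1 : DifferentiableOn ℂ cayleyInv (Metric.ball 0 1) := by
    refine DifferentiableOn.div (by fun_prop) (by fun_prop) fun z hz h ↦ ?_
    rw [mem_ball_zero_iff, ← sub_eq_zero.mp h, norm_one] at hz
    exact lt_irrefl _ hz
  exact (hB.analytic.comp h1 fun z hz ↦ im_cayleyInv_pos (by simpa using hz)).mul_const _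

theorem existsUnique_diskClarkMeasure (hB : IsContractiveAnalytic upperHalf B)
    (hα : α ∈ Matrix.unitaryGroup (Fin n) ℂ) (hinv : ∀ w ∈ upperHalf, IsUnit (1 - B w * αᴴ)) :
    ∃! ν : VectorMeasure UnitCircle (Matrix (Fin n) (Fin n) ℂ),
      IsDiskClarkMeasure (fun z ↦ B (cayleyInv z) * αᴴ) ν := by
  have hmem {z : ℂ} (hz : z ∈ Metric.ball (0 : ℂ) 1) : cayleyInv z ∈ upperHalf :=
    im_cayleyInv_pos (by simpa using hz)
  obtain ⟨ν, hν, hp⟩ := exists_vectorMeasure_poisson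
    (differentiableOn_herglotz (differentiableOn_disk (α := α) hB) fun z hz ↦ hinv _ (hmem hz))
    -- Right multiplication by the unitary `α*` preserves the norm, so `b α*` is contractive along
    -- with `b`.
    fun z hz v ↦ re_quadForm_cayley_nonneg ((CStarRing.norm_mul_mem_unitary _
      (Unitary.star_mem hα)).trans_le (hB.contractive _ (hmem hz))) (hinv _ (hmem hz)) v
  refine ⟨ν, ⟨hν, fun z hz ↦ ?_⟩, fun ν' hν' ↦ vectorMeasure_ext_of_poisson fun z hz ↦ ?_⟩
  · simp only [← poissonKernel_unitCircle]
    exact hp z hz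
  · rw [← hp z hz, hν'.poisson z hz]
    simp only [poissonKernel_unitCircle]

theorem density_integrable (ν : VectorMeasure ℝ (Matrix (Fin n) (Fin n) ℂ)) :
    ν.Integrable fun t : ℝ ↦ 1 / (Real.pi * (1 + t ^ 2)) := by
  have := isFiniteMeasure_variation ν
  have hc : Continuous fun t : ℝ ↦ 1 / (Real.pi * (1 + t ^ 2)) :=
    Continuous.div (by fun_prop) (by fun_prop) fun t ↦ by positivity
  refine Integrable.of_bound hc.aestronglyMeasurable 1 (Filter.Eventually.of_forall fun t ↦ ?_)
  rw [Real.norm_of_nonneg (by positivity), div_le_one (by positivity)]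
  nlinarith [Real.two_le_pi, sq_nonneg t]

theorem withDensity_cayleyPullback_singleton
    (ν : VectorMeasure UnitCircle (Matrix (Fin n) (Fin n) ℂ)) (s : ℝ) :
    (cayleyPullback ν).withDensity (fun t : ℝ ↦ 1 / (Real.pi * (1 + t ^ 2)))
      (ContinuousLinearMap.lsmul ℝ ℝ) {s} =
      (1 / (Real.pi * (1 + s ^ 2))) • ν {l : UnitCircle | (l : ℂ) = cayley s} := by
  rw [VectorMeasure.withDensity_apply (density_integrable _), VectorMeasure.integral_singleton,
    cayleyPullback_apply ν (measurableSet_singleton s)]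
  simp

end MatrixClark

/-! ### The main theorem -/

theorem mainTheorem2 {n : ℕ} (B : ℂ → Matrix (Fin n) (Fin n) ℂ)
    (hB : MatrixClark.IsContractiveAnalytic MatrixClark.upperHalf B)
    (α : Matrix (Fin n) (Fin n) ℂ) (hα : α ∈ Matrix.unitaryGroup (Fin n) ℂ)
    (hinv : ∀ w ∈ MatrixClark.upperHalf, IsUnit (1 - B w * αᴴ)) :
    (∃! μ : MeasureTheory.VectorMeasure ℝ (Matrix (Fin n) (Fin n) ℂ),
        MatrixClark.IsClarkMeasure B α μ) ∧
    ∀ μ : MeasureTheory.VectorMeasure ℝ (Matrix (Fin n) (Fin n) ℂ),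
      MatrixClark.IsClarkMeasure B α μ →
      ∀ s : ℝ, ∃ L : Matrix (Fin n) (Fin n) ℂ,
        MatrixClark.NontangentialTendsto
          (fun w : ℂ => ((s : ℂ) - w) • (1 - B w * αᴴ)⁻¹) s L ∧
        μ {s} = ((2 * Complex.I) / ((Real.pi : ℂ) * (1 + (s : ℂ) ^ 2) ^ 2)) • L := by
  open MatrixClark in
  constructor
  · obtain ⟨ν, hν, huniq⟩ := existsUnique_diskClarkMeasure hB hα hinv
    refine ⟨_, ⟨ν, hν, rfl⟩, ?_⟩
    rintro μ ⟨ν', hν', rfl⟩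
    rw [huniq ν' hν']
  · rintro μ ⟨ν, hν, rfl⟩ s
    -- Half the limit of `(s - w) H(γ(w))`: since `(1 - C)⁻¹ = (H + 1)/2`, and `(s - w) • 1` tends
    -- to `0`, only the `H` term contributes.
    refine ⟨(2⁻¹ : ℂ) • (-Complex.I * (1 + (s : ℂ) ^ 2)) •
      ν {l : UnitCircle | (l : ℂ) = cayley s}, fun κ _ ↦ ?_, ?_⟩
    · have hd := differentiableOn_herglotz (differentiableOn_disk (α := α) hB)
        fun z hz ↦ hinv _ (im_cayleyInv_pos (by simpa using hz))
      have h1 := tendsto_smul_comp_cayley hd hν.posSemidef (fun z hz ↦ by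
        rw [hν.poisson z hz]
        simp only [poissonKernel_unitCircle]) s κ
      have h2 : Filter.Tendsto (fun w : ℂ ↦ ((s : ℂ) - w) • (1 : Matrix (Fin n) (Fin n) ℂ))
          (𝓝[{w : ℂ | 0 < w.im ∧ |w.re - s| ≤ κ * w.im}] (s : ℂ)) (𝓝 0) := by
        have h : ContinuousAt (fun w : ℂ ↦ ((s : ℂ) - w) • (1 : Matrix (Fin n) (Fin n) ℂ))
          (s : ℂ) := by fun_prop
        have := h.tendsto.mono_left
          (nhdsWithin_le_nhds (s := {w : ℂ | 0 < w.im ∧ |w.re - s| ≤ κ * w.im}))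
        simpa only [sub_self, zero_smul] using this
      have h3 := (h1.add h2).const_smul (2⁻¹ : ℂ)
      rw [add_zero] at h3
      refine h3.congr' ?_
      filter_upwards [self_mem_nhdsWithin] with w hw
      have hdet := (Matrix.isUnit_iff_isUnit_det _).mp (hinv w hw.1)
      have h4 : herglotz (fun z ↦ B (cayleyInv z) * αᴴ) (cayley w) =
          (2 : ℂ) • (1 - B w * αᴴ)⁻¹ - 1 := by
        have h5 : 1 + B w * αᴴ = (2 : ℂ) • (1 : Matrix (Fin n) (Fin n) ℂ) - (1 - B w * αᴴ) := by
          rw [two_smul]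
          abel
        rw [herglotz, cayleyInv_cayley hw.1.le, h5, mul_sub, Matrix.nonsing_inv_mul _ hdet,
          mul_smul_comm, mul_one]
      rw [h4, ← smul_add, sub_add_cancel, smul_comm, smul_smul (2⁻¹ : ℂ)]
      simp
    -- The constants agree because `2i · 2⁻¹ · (-i) = 1` and one factor `1 + s²` cancels, leaving
    -- the density `1 / (π (1 + s²))`.
    · rw [withDensity_cayleyPullback_singleton, smul_smul, smul_smul, ← Complex.coe_smul]
      congr 1
      have h1 : (1 : ℂ) + (s : ℂ) ^ 2 ≠ 0 := by
        have : (1 : ℝ) + s ^ 2 ≠ 0 := by positivity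
        exact_mod_cast this
      have h2 : (Real.pi : ℂ) ≠ 0 := Complex.ofReal_ne_zero.mpr Real.pi_ne_zero
      push_cast
      field_simp
      linear_combination Complex.I_sq
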